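/- Let $X$ be a real ordered Banach space, that is, a real Banach space with a partial order compatible with its vector space structure whose positive cone $K=\{x\in X: x\ge 0\}$ is closed; write $x>0$ if $x\in K$, $x\neq 0$, and $x<0$ if $-x>0$. Let $Y$ be a real vector space (for instance $Y=X$), let $L$ be a (possibly unbounded) linear operator that maps its domain, a linear subspace of $X$, bijectively onto $Y$, and let $M:X\to Y$ be linear. Assume that $T:=L^{-1}M:X\to X$ is a bounded operator that is strongly positive, i.e. $Tx\in\operatorname{int}K$ for every $x>0$. Let $r_{L^{-1}M}$ denote the spectral radius of $T$ (the supremum of $|z|$ over the complex spectrum of the complexification of $T$). Let $\tau_*\in\mathbb R$, $\phi\in X$ and $y\in Y$ satisfy $\phi>0$ and $$\tau_*\phi-L^{-1}M\phi=L^{-1}y .$$ 1. If $L^{-1}y<0$, then $r_{L^{-1}M}>\tau_*$. 2. If $L^{-1}y>0$, and if moreover $T$ is compact or $K$ is normal (i.e. there is a constant $C$ with $\|x\|\le C\|z\|$ whenever $0\le x\le z$), then $r_{L^{-1}M}<\tau_*$. -/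

import Mathlib

/-- The inverse `L⁻¹ : Y → X` of a (possibly unbounded) linear operator `L` from its domain in `X`
to `Y`, which is a bijection from its domain onto `Y`. -/
noncomputable def solutionOperator {X Y : Type*} [AddCommGroup X] [Module ℝ X]
    [AddCommGroup Y] [Module ℝ Y] (L : X →ₗ.[ℝ] Y) (hL : Function.Bijective L.toFun) : Y →ₗ[ℝ] X :=
  L.domain.subtype ∘ₗ ((LinearEquiv.ofBijective L.toFun hL).symm : Y →ₗ[ℝ] L.domain)

/-- `T` is strongly positive: it maps nonzero elements of the positive cone `{x | 0 ≤ x}`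
into the interior of that cone. (In a partial order `0 < x` means `0 ≤ x` and `x ≠ 0`.) -/
def IsStronglyPositive {X : Type*} [NormedAddCommGroup X] [NormedSpace ℝ X] [PartialOrder X]
    (T : X →L[ℝ] X) : Prop :=
  ∀ x : X, 0 < x → T x ∈ interior {z : X | 0 ≤ z}

/-- The positive cone of `X` is normal: the norm is monotone on it up to a constant. -/
def HasNormalCone (X : Type*) [NormedAddCommGroup X] [PartialOrder X] : Prop :=
  ∃ C : ℝ, ∀ x y : X, 0 ≤ x → x ≤ y → ‖x‖ ≤ C * ‖y‖

/-- The spectral radius of a bounded operator `T` on a real Banach space: the supremum of `|z|` over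
the complex numbers `z` in the spectrum of the complexification of `T`. The complexified algebra
`ℂ ⊗ (X →L[ℝ] X)` over `ℝ` is the algebra of bounded operators on the complexification of `X`, and
`includeRight T = 1 ⊗ T` is the complexification of `T`. -/
noncomputable def operatorSpectralRadius {X : Type*} [NormedAddCommGroup X] [NormedSpace ℝ X]
    (T : X →L[ℝ] X) : ENNReal :=
  spectralRadius ℂ (Algebra.TensorProduct.includeRight (R := ℝ) (A := ℂ) T)

/-! Put `u = T φ`, an interior point of the cone, and `f = L⁻¹ y`. Applying `T` to the equation
gives `T u = τ u - T f`. Strong positivity makes `± T f` dominate some `ε u`, so `(τ + ε) u ≤ T u`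
if `f < 0` and `T u ≤ (τ - ε) u` if `f > 0`. Lower bound: `s ^ n u ≤ T ^ n u` is incompatible with
`‖T ^ n‖ = o(s ^ n)`, which Gelfand's formula gives when the spectral radius is below `s`. Upper
bound: every `x` lies between multiples of `u`. For a normal cone this gives `‖T ^ n‖ ≤ C s ^ n`.
For compact `T`, a spectral value with `|z| > s` yields an invariant subspace contained in the cone,
hence zero. -/

/-! ### Spectral values of the complexified operator -/

open scoped TensorProduct in
/-- If the quadratic polynomial with roots `z`, `conj z` takes an invertible value at `a`, then `z`
is not in the spectrum of the complexification of `a`. -/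
theorem isUnit_algebraMap_sub_includeRight {B : Type*} [Ring B] [Algebra ℝ B] (z : ℂ) (a : B)
    (h : IsUnit (a * a - (2 * z.re) • a + Complex.normSq z • (1 : B))) :
    IsUnit (algebraMap ℂ (ℂ ⊗[ℝ] B) z -
      Algebra.TensorProduct.includeRight (R := ℝ) (A := ℂ) a) := by
  have h1 := h.map (Algebra.TensorProduct.includeRight (R := ℝ) (A := ℂ) (B := B))
  set b := Algebra.TensorProduct.includeRight (R := ℝ) (A := ℂ) a with hb
  have hcomm (u v : ℂ) : Commute (algebraMap ℂ (ℂ ⊗[ℝ] B) u - b) (algebraMap ℂ _ v - b) :=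
    ((Algebra.commute_algebraMap_left u _).sub_right (Algebra.commute_algebraMap_left u b)).sub_left
      ((Algebra.commute_algebraMap_right v b).sub_right (Commute.refl b))
  have hprod : (algebraMap ℂ (ℂ ⊗[ℝ] B) z - b) *
      (algebraMap ℂ (ℂ ⊗[ℝ] B) (starRingEnd ℂ z) - b) =
      Algebra.TensorProduct.includeRight (R := ℝ) (A := ℂ)
        (a * a - (2 * z.re) • a + Complex.normSq z • (1 : B)) := by
    have h2 : algebraMap ℂ (ℂ ⊗[ℝ] B) z + algebraMap ℂ (ℂ ⊗[ℝ] B) (starRingEnd ℂ z) =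
        algebraMap ℝ _ (2 * z.re) := by
      rw [← map_add, Complex.add_conj, IsScalarTower.algebraMap_apply ℝ ℂ]
      simp
    have h3 : algebraMap ℂ (ℂ ⊗[ℝ] B) z * algebraMap ℂ (ℂ ⊗[ℝ] B) (starRingEnd ℂ z) =
        algebraMap ℝ _ (Complex.normSq z) := by
      rw [← map_mul, Complex.mul_conj, IsScalarTower.algebraMap_apply ℝ ℂ]
      simp
    rw [map_add, map_sub, map_mul, map_smul, map_smul, map_one, ← hb, Algebra.smul_def,
      Algebra.smul_def, mul_one, ← h2, ← h3]
    rw [sub_mul, mul_sub, mul_sub, ← Algebra.commutes (starRingEnd ℂ z) b, add_mul]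
    abel
  rw [← hprod] at h1
  exact ((hcomm _ _).isUnit_mul_iff.mp h1).1

-- A Neumann series inverts the real quadratic, so no norm on the tensor product is needed. The
-- factor 4 is crude but disappears on passing to powers.
open scoped TensorProduct in
theorem norm_le_four_mul_of_mem_spectrum_includeRight {B : Type*} [NormedRing B]
    [NormedAlgebra ℝ B] [CompleteSpace B] (a : B) {z : ℂ}
    (hz : z ∈ spectrum ℂ (Algebra.TensorProduct.includeRight (R := ℝ) (A := ℂ) a)) :
    ‖z‖ ≤ 4 * ‖a‖ := by
  by_contra! hlt
  refine hz (isUnit_algebraMap_sub_includeRight z a ?_)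
  have hz0 : 0 < ‖z‖ := lt_of_le_of_lt (by positivity) hlt
  have hq : a * a - (2 * z.re) • a + Complex.normSq z • (1 : B) =
      (‖z‖ ^ 2) • (1 - (‖z‖ ^ 2)⁻¹ • ((2 * z.re) • a - a * a)) := by
    rw [smul_sub, smul_inv_smul₀ (by positivity), Complex.normSq_eq_norm_sq]
    abel
  rw [hq]
  have hunit : IsUnit (1 - (‖z‖ ^ 2)⁻¹ • ((2 * z.re) • a - a * a)) := by
    apply isUnit_one_sub_of_norm_lt_one
    rw [norm_smul, norm_inv, norm_pow, norm_norm, inv_mul_lt_iff₀ (by positivity), mul_one]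
    have h1 : ‖(2 * z.re) • a‖ ≤ 2 * ‖z‖ * ‖a‖ := by
      rw [norm_smul, norm_mul]
      have := Complex.abs_re_le_norm z
      gcongr
      · simp
      · simpa using this
    have h2 := norm_mul_le a a
    have h3 := norm_sub_le ((2 * z.re) • a) (a * a)
    nlinarith [norm_nonneg a]
  exact hunit.smul (Units.mk0 (‖z‖ ^ 2) (by positivity))

open scoped TensorProduct in
/-- Geometric growth of the powers bounds the spectrum of the complexification. -/
theorem norm_le_of_mem_spectrum_includeRight_of_pow_le {B : Type*} [NormedRing B]
    [NormedAlgebra ℝ B] [CompleteSpace B] (a : B) {C s : ℝ} (hs : 0 < s)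
    (ha : ∀ n : ℕ, ‖a ^ n‖ ≤ C * s ^ n) {z : ℂ}
    (hz : z ∈ spectrum ℂ (Algebra.TensorProduct.includeRight (R := ℝ) (A := ℂ) a)) :
    ‖z‖ ≤ s := by
  have hbound (n : ℕ) : (‖z‖ / s) ^ n ≤ 4 * C := by
    have h := spectrum.pow_mem_pow _ n hz
    rw [← map_pow] at h
    have h' := norm_le_four_mul_of_mem_spectrum_includeRight _ h
    rw [norm_pow] at h'
    rw [div_pow, div_le_iff₀ (by positivity)]
    linarith [ha n]
  by_contra! hlt
  obtain ⟨n, hn⟩ := pow_unbounded_of_one_lt (4 * C) ((one_lt_div hs).mpr hlt)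
  exact absurd (hbound n) (not_le.mpr hn)

/-- A nonzero spectral value `z` of the complexification of a compact operator `T` comes with a
nonzero real-linear map from `ℂ` intertwining multiplication by `z` and `T`. -/
theorem IsCompactOperator.exists_intertwining_of_mem_spectrum {X : Type*} [NormedAddCommGroup X]
    [NormedSpace ℝ X] [CompleteSpace X] {T : X →L[ℝ] X} (hT : IsCompactOperator T) {z : ℂ}
    (hz0 : z ≠ 0)
    (hz : z ∈ spectrum ℂ (Algebra.TensorProduct.includeRight (R := ℝ) (A := ℂ) T)) :
    ∃ g : ℂ →L[ℝ] X, g ≠ 0 ∧ ∀ c, T (g c) = g (z * c) := by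
  have hn0 : -Complex.normSq z ≠ 0 := by simpa using hz0
  have hcpt : IsCompactOperator (T * T - (2 * z.re) • T : X →L[ℝ] X) :=
    (hT.comp_clm T).sub (hT.smul (2 * z.re))
  have hev := (hcpt.hasEigenvalue_or_mem_resolventSet hn0).resolve_right fun h ↦ by
    refine hz (isUnit_algebraMap_sub_includeRight z T ?_)
    rw [spectrum.mem_resolventSet_iff] at h
    have h2 := h.neg
    rwa [Algebra.algebraMap_eq_smul_one, neg_sub, neg_smul, sub_neg_eq_add] at h2
  obtain ⟨x, hx⟩ := hev.exists_hasEigenvector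
  have hx0 := hx.2
  have hTx : T (T x) - (2 * z.re) • T x = -Complex.normSq z • x := hx.apply_eq_smul
  -- The second map below encodes the eigenvector `(T - conj z) x`. It vanishes exactly when `z` is
  -- real and `T x = z x`, and then `x` itself serves.
  by_cases hc : T x = z.re • x ∧ z.im = 0
  · refine ⟨Complex.reCLM.smulRight x, fun h ↦ hx0 ?_, fun c ↦ ?_⟩
    · simpa using DFunLike.congr_fun h 1
    · simp [hc.1, hc.2, smul_smul, mul_comm]
  · refine ⟨Complex.reCLM.smulRight (T x - z.re • x) - Complex.imCLM.smulRight (z.im • x),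
      fun h ↦ hc ?_, fun c ↦ ?_⟩
    · have h1 := DFunLike.congr_fun h 1
      have h2 := DFunLike.congr_fun h Complex.I
      simp [sub_eq_zero, hx0] at h1 h2
      exact ⟨h1, h2⟩
    · rw [sub_eq_iff_eq_add] at hTx
      simp [hTx, Complex.normSq_apply]
      module

/-! ### Normed complexification and growth of powers -/

/-- The complexification of a real normed space `X`, realized as the space of real-linear maps from
`ℂ` to `X`, on which `ℂ` acts through its multiplication. -/
def Complexified (X : Type*) [NormedAddCommGroup X] [NormedSpace ℝ X] : Type _ := ℂ →L[ℝ] X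

namespace Complexified

variable {X : Type*} [NormedAddCommGroup X] [NormedSpace ℝ X]

noncomputable instance : NormedAddCommGroup (Complexified X) :=
  inferInstanceAs (NormedAddCommGroup (ℂ →L[ℝ] X))

noncomputable instance : NormedSpace ℝ (Complexified X) :=
  inferInstanceAs (NormedSpace ℝ (ℂ →L[ℝ] X))

instance [CompleteSpace X] : CompleteSpace (Complexified X) :=
  inferInstanceAs (CompleteSpace (ℂ →L[ℝ] X))

/-- The identification of `Complexified X` with a space of real-linear maps. -/
def toCLM (g : Complexified X) : ℂ →L[ℝ] X := g

/-- The identification of a space of real-linear maps with `Complexified X`. -/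
def ofCLM (g : ℂ →L[ℝ] X) : Complexified X := g

@[ext] theorem ext {g h : Complexified X} (H : ∀ c, g.toCLM c = h.toCLM c) : g = h :=
  ContinuousLinearMap.ext H

noncomputable instance : SMul ℂ (Complexified X) :=
  ⟨fun z g ↦ ofCLM (g.toCLM ∘L ContinuousLinearMap.mul ℝ ℂ z)⟩

@[simp] theorem toCLM_smul (z : ℂ) (g : Complexified X) (c : ℂ) :
    (z • g).toCLM c = g.toCLM (z * c) := rfl

@[simp] theorem toCLM_ofCLM (g : ℂ →L[ℝ] X) : (ofCLM g).toCLM = g := rfl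

@[simp] theorem toCLM_add (g h : Complexified X) : (g + h).toCLM = g.toCLM + h.toCLM := rfl

@[simp] theorem toCLM_zero : (0 : Complexified X).toCLM = 0 := rfl

@[simp] theorem toCLM_real_smul (r : ℝ) (g : Complexified X) : (r • g).toCLM = r • g.toCLM := rfl

theorem norm_def (g : Complexified X) : ‖g‖ = ‖g.toCLM‖ := rfl

noncomputable instance : Module ℂ (Complexified X) where
  one_smul g := by ext; simp
  mul_smul z w g := by ext; simp only [toCLM_smul]; ring_nf
  smul_zero z := by ext; simp
  smul_add z g h := by ext; simp
  add_smul z w g := by ext; simp [add_mul]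
  zero_smul g := by ext; simp

/-- The operator norm is complex homogeneous because `|z c| = |z| |c|`. -/
noncomputable instance : NormedSpace ℂ (Complexified X) where
  norm_smul_le z g := by
    refine ContinuousLinearMap.opNorm_le_bound _ (by positivity) fun c ↦ ?_
    change ‖g.toCLM (z * c)‖ ≤ ‖z‖ * ‖g.toCLM‖ * ‖c‖
    refine (g.toCLM.le_opNorm _).trans_eq ?_
    rw [norm_mul]
    ring

instance : IsScalarTower ℝ ℂ (Complexified X) where
  smul_assoc r z g := by
    ext c
    simp only [toCLM_smul, toCLM_real_smul, smul_apply, smul_mul_assoc,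
      map_smul]

/-- The complexification of a bounded operator. -/
noncomputable def mapCLM (S : X →L[ℝ] X) : Complexified X →L[ℂ] Complexified X :=
  LinearMap.mkContinuous
    { toFun := fun g ↦ ofCLM (S ∘L g.toCLM)
      map_add' := fun g h ↦ by ext; simp
      map_smul' := fun z g ↦ by ext; simp } ‖S‖ fun g ↦ S.opNorm_comp_le g.toCLM

@[simp] theorem toCLM_mapCLM (S : X →L[ℝ] X) (g : Complexified X) (c : ℂ) :
    (mapCLM S g).toCLM c = S (g.toCLM c) := rfl

/-- Complexification of bounded operators, as a homomorphism of real algebras. -/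
noncomputable def mapAlgHom :
    (X →L[ℝ] X) →ₐ[ℝ] (Complexified X →L[ℂ] Complexified X) :=
  AlgHom.ofLinearMap
    { toFun := mapCLM
      map_add' := fun S S' ↦ by ext; simp
      map_smul' := fun r S ↦ by ext; simp }
    (by ext; simp) (fun S S' ↦ by ext; simp)

@[simp] theorem toCLM_mapAlgHom (S : X →L[ℝ] X) (g : Complexified X) (c : ℂ) :
    (mapAlgHom S g).toCLM c = S (g.toCLM c) := rfl

/-- Algebra homomorphisms shrink spectra; this one inequality suffices, without identifying the two
algebras. -/
theorem spectralRadius_mapAlgHom_le (T : X →L[ℝ] X) :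
    spectralRadius ℂ (mapAlgHom T) ≤
      spectralRadius ℂ (Algebra.TensorProduct.includeRight (R := ℝ) (A := ℂ) T) := by
  let f : TensorProduct ℝ ℂ (X →L[ℝ] X) →ₐ[ℂ] (Complexified X →L[ℂ] Complexified X) :=
    Algebra.TensorProduct.lift (Algebra.ofId ℂ _) mapAlgHom
      fun z S ↦ Algebra.commute_algebraMap_left z (mapAlgHom S)
  have hf : f (Algebra.TensorProduct.includeRight T) = mapAlgHom T := by
    change Algebra.ofId ℂ _ 1 * mapAlgHom T = mapAlgHom T
    rw [map_one, one_mul]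
  have h := AlgHom.spectrum_apply_subset f (Algebra.TensorProduct.includeRight T)
  rw [hf] at h
  exact biSup_mono h

theorem norm_le_norm_mapAlgHom (S : X →L[ℝ] X) : ‖S‖ ≤ ‖mapAlgHom S‖ := by
  refine S.opNorm_le_bound (norm_nonneg _) fun x ↦ ?_
  have h := (mapAlgHom S).le_opNorm (ofCLM (Complex.reCLM.smulRight x))
  have h1 : ‖ofCLM (Complex.reCLM.smulRight x)‖ = ‖x‖ := by
    simp [norm_def]
  have h2 : ‖S x‖ ≤ ‖mapAlgHom S (ofCLM (Complex.reCLM.smulRight x))‖ := by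
    have := (mapAlgHom S (ofCLM (Complex.reCLM.smulRight x))).toCLM.le_opNorm 1
    simpa [norm_def] using this
  rw [h1] at h
  exact h2.trans h

end Complexified

open Filter Topology in
/-- If the spectral radius of `T` is less than `s`, then `‖T ^ n‖ = o(s ^ n)`. -/
theorem tendsto_norm_pow_div_pow_of_operatorSpectralRadius_lt {X : Type*} [NormedAddCommGroup X]
    [NormedSpace ℝ X] [CompleteSpace X] (T : X →L[ℝ] X) {s : NNReal}
    (h : operatorSpectralRadius T < s) :
    Tendsto (fun n : ℕ ↦ ‖T ^ n‖ / s ^ n) atTop (𝓝 0) := by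
  -- The room between `t` and `s` gives decay like `(t / s) ^ n`.
  obtain ⟨t, ht1, ht2⟩ := ENNReal.lt_iff_exists_nnreal_btwn.mp h
  have hts : t < s := by exact_mod_cast ht2
  have hs : (0 : ℝ) < s := (zero_le (a := t)).trans_lt hts
  have hev := (spectrum.pow_nnnorm_pow_one_div_tendsto_nhds_spectralRadius
    (Complexified.mapAlgHom T)).eventually_lt_const
      ((Complexified.spectralRadius_mapAlgHom_le T).trans_lt ht1)
  have hgeo : Tendsto (fun n : ℕ ↦ ((t : ℝ) / s) ^ n) atTop (𝓝 0) :=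
    tendsto_pow_atTop_nhds_zero_of_lt_one (by positivity)
      ((div_lt_one hs).mpr (by exact_mod_cast hts))
  refine squeeze_zero' (Eventually.of_forall fun n ↦ by positivity) ?_ hgeo
  filter_upwards [hev, eventually_gt_atTop 0] with n hn hn0
  have hn0' : (0 : ℝ) < n := by exact_mod_cast hn0
  rw [div_pow]
  gcongr
  rw [one_div, ENNReal.rpow_inv_lt_iff hn0', ENNReal.rpow_natCast] at hn
  have hn' : ‖Complexified.mapAlgHom T ^ n‖₊ < t ^ n := by exact_mod_cast hn
  rw [← map_pow] at hn'
  exact (Complexified.norm_le_norm_mapAlgHom _).trans (by exact_mod_cast hn'.le)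

/-! ### Interior points of the cone -/

theorem exists_forall_norm_le_add_nonneg {X : Type*} [NormedAddCommGroup X] [PartialOrder X] {u : X} (hu : u ∈ interior {z : X | 0 ≤ z}) :
    ∃ ε : ℝ, 0 < ε ∧ ∀ w : X, ‖w‖ ≤ ε → 0 ≤ u + w := by
  obtain ⟨ε, hε, h⟩ := Metric.nhds_basis_closedBall.mem_iff.mp (mem_interior_iff_mem_nhds.mp hu)
  exact ⟨ε, hε, fun w hw ↦ h (by simpa using hw)⟩

theorem exists_pos_smul_le {X : Type*} [NormedAddCommGroup X] [NormedSpace ℝ X]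
    [PartialOrder X] [IsOrderedAddMonoid X] {u : X}
    (hu : u ∈ interior {z : X | 0 ≤ z}) (v : X) :
    ∃ ε : ℝ, 0 < ε ∧ ε • v ≤ u := by
  obtain ⟨δ, hδ, h⟩ := exists_forall_norm_le_add_nonneg hu
  refine ⟨δ / (‖v‖ + 1), by positivity, ?_⟩
  rw [← sub_nonneg, sub_eq_add_neg]
  refine h _ ?_
  rw [norm_neg, norm_smul, Real.norm_of_nonneg (by positivity), div_mul_eq_mul_div,
    div_le_iff₀ (by positivity)]
  nlinarith [norm_nonneg v]

/-- In the presence of an interior point `u` of the cone, the norm dominates the order. -/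
theorem exists_forall_add_norm_smul_nonneg {X : Type*} [NormedAddCommGroup X] [NormedSpace ℝ X]
    [PartialOrder X] [IsOrderedModule ℝ X] {u : X}
    (hu : u ∈ interior {z : X | 0 ≤ z}) :
    ∃ c : ℝ, 0 < c ∧ ∀ x : X, 0 ≤ (c * ‖x‖) • u + x := by
  obtain ⟨ε, hε, h⟩ := exists_forall_norm_le_add_nonneg hu
  refine ⟨ε⁻¹, by positivity, fun x ↦ ?_⟩
  rcases eq_or_ne x 0 with rfl | hx
  · simp
  have hx' : 0 < ‖x‖ := norm_pos_iff.mpr hx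
  have h1 := h ((ε / ‖x‖) • x) (by
    rw [norm_smul, Real.norm_of_nonneg (by positivity)]
    exact (div_mul_cancel₀ _ hx'.ne').le)
  have h2 := smul_nonneg (show 0 ≤ ε⁻¹ * ‖x‖ by positivity) h1
  rwa [smul_add, smul_smul, show ε⁻¹ * ‖x‖ * (ε / ‖x‖) = 1 by field_simp, one_smul] at h2

/-! ### Strongly positive operators: subsolutions and supersolutions -/

namespace IsStronglyPositive

theorem map_nonneg {X : Type*} [NormedAddCommGroup X] [NormedSpace ℝ X]
    [PartialOrder X] {T : X →L[ℝ] X} (hT : IsStronglyPositive T) {x : X} (hx : 0 ≤ x) : 0 ≤ T x := by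
  rcases hx.eq_or_lt with rfl | hx
  · simp
  · exact interior_subset (hT x hx)

theorem pow_nonneg {X : Type*} [NormedAddCommGroup X] [NormedSpace ℝ X]
    [PartialOrder X] {T : X →L[ℝ] X} (hT : IsStronglyPositive T) {x : X} (hx : 0 ≤ x) (n : ℕ) : 0 ≤ (T ^ n) x := by
  induction n with
  | zero => simpa using hx
  | succ n ih => rw [pow_succ']; exact hT.map_nonneg ih

theorem pow_mono {X : Type*} [NormedAddCommGroup X] [NormedSpace ℝ X]
    [PartialOrder X] [IsOrderedAddMonoid X] {T : X →L[ℝ] X} (hT : IsStronglyPositive T) {x y : X} (h : x ≤ y) (n : ℕ) :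
    (T ^ n) x ≤ (T ^ n) y := by
  have := hT.pow_nonneg (sub_nonneg.mpr h) n
  rwa [map_sub, sub_nonneg] at this

variable {X : Type*} [NormedAddCommGroup X] [NormedSpace ℝ X] [PartialOrder X]
  [IsOrderedAddMonoid X] [IsOrderedModule ℝ X] {T : X →L[ℝ] X}

/-- If `T x = 0`, then 0 is interior to the cone, so some `ε x ≤ 0`, contradicting `x > 0`. -/
theorem map_pos (hT : IsStronglyPositive T) {x : X} (hx : 0 < x) : 0 < T x := by
  refine (hT.map_nonneg hx.le).lt_of_ne fun h0 ↦ ?_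
  have h := hT x hx
  rw [← h0] at h
  obtain ⟨ε, hε, h⟩ := exists_pos_smul_le h x
  have h1 := h.antisymm (smul_nonneg hε.le hx.le)
  exact hx.ne' ((smul_eq_zero.mp h1).resolve_left hε.ne')

theorem smul_pow_le (hT : IsStronglyPositive T) {x : X} {s : ℝ} (hs : 0 ≤ s) (h : s • x ≤ T x)
    (n : ℕ) : s ^ n • x ≤ (T ^ n) x := by
  induction n with
  | zero => simp
  | succ n ih =>
    have h1 := hT.pow_mono h n
    rw [map_smul] at h1
    rw [pow_succ T, pow_succ', mul_smul]
    exact (smul_le_smul_of_nonneg_left ih hs).trans h1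

theorem le_smul_pow (hT : IsStronglyPositive T) {x : X} {s : ℝ} (hs : 0 ≤ s) (h : T x ≤ s • x)
    (n : ℕ) : (T ^ n) x ≤ s ^ n • x := by
  induction n with
  | zero => simp
  | succ n ih =>
    have h1 := hT.pow_mono h n
    rw [map_smul] at h1
    rw [pow_succ T, pow_succ', mul_smul]
    exact h1.trans (smul_le_smul_of_nonneg_left ih hs)

open Filter Topology in
/-- A positive subsolution `s • x ≤ T x` bounds the spectral radius from below. -/
theorem le_operatorSpectralRadius [CompleteSpace X] [OrderClosedTopology X]
    (hT : IsStronglyPositive T) {x : X} (hx : 0 < x) {s : NNReal} (h : (s : ℝ) • x ≤ T x) :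
    s ≤ operatorSpectralRadius T := by
  by_contra! hlt
  have hs : (0 : ℝ) < s := by
    have : (0 : ENNReal) < s := (zero_le (a := operatorSpectralRadius T)).trans_lt hlt
    exact_mod_cast this
  have hlim := tendsto_norm_pow_div_pow_of_operatorSpectralRadius_lt T hlt
  have hlim0 : Tendsto (fun n : ℕ ↦ ((s : ℝ) ^ n)⁻¹ • (T ^ n) x) atTop (𝓝 0) := by
    refine squeeze_zero_norm (fun n ↦ ?_) (by simpa using hlim.mul_const ‖x‖)
    rw [norm_smul, norm_inv, norm_pow, Real.norm_of_nonneg hs.le, div_mul_eq_mul_div,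
      inv_mul_eq_div]
    gcongr
    exact (T ^ n).le_opNorm x
  have hle : x ≤ 0 := by
    refine ge_of_tendsto' hlim0 fun n ↦ ?_
    have h1 := smul_le_smul_of_nonneg_left (hT.smul_pow_le hs.le h n)
      (inv_nonneg.mpr (_root_.pow_nonneg hs.le n))
    rwa [inv_smul_smul₀ (pow_ne_zero n hs.ne')] at h1
  exact absurd hx hle.not_gt

/-- With a normal cone, an interior supersolution `T u ≤ s • u` bounds the growth of `T ^ n`. -/
theorem exists_norm_pow_le (hT : IsStronglyPositive T) (hK : HasNormalCone X) {u : X}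
    (hu : u ∈ interior {z : X | 0 ≤ z}) {s : ℝ} (hs : 0 ≤ s) (h : T u ≤ s • u) :
    ∃ C : ℝ, ∀ n : ℕ, ‖T ^ n‖ ≤ C * s ^ n := by
  obtain ⟨C, hC⟩ := hK
  obtain ⟨c, hc, hcu⟩ := exists_forall_add_norm_smul_nonneg hu
  have hu0 : 0 ≤ u := interior_subset hu
  have hmain (n : ℕ) (x : X) : ‖(T ^ n) x‖ ≤ (3 * |C| * c * ‖u‖) * s ^ n * ‖x‖ := by
    -- From `-k u ≤ x ≤ k u`, the shift `k u + x` lies in `[0, 2k u]`, where normality applies.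
    set k := c * ‖x‖ with hk
    have hk0 : 0 ≤ k := by positivity
    have hun := hT.le_smul_pow hs h n
    have h1 : 0 ≤ (T ^ n) (k • u + x) := hT.pow_nonneg (hcu x) n
    have h2 : (T ^ n) (k • u + x) ≤ (T ^ n) ((2 * k) • u) := by
      refine hT.pow_mono ?_ n
      have := hcu (-x)
      rw [norm_neg, ← hk] at this
      rw [← sub_nonneg]
      convert this using 1
      module
    have h3 : (T ^ n) ((2 * k) • u) ≤ (2 * k * s ^ n) • u := by
      rw [map_smul, mul_smul (2 * k)]
      exact smul_le_smul_of_nonneg_left hun (by positivity)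
    have h4 := hC _ _ h1 (h2.trans h3)
    have h5 : ‖(T ^ n) u‖ ≤ |C| * (s ^ n * ‖u‖) := by
      have := hC _ _ (hT.pow_nonneg hu0 n) hun
      rw [norm_smul, Real.norm_of_nonneg (by positivity)] at this
      exact this.trans (by gcongr; exact le_abs_self C)
    have h6 : (T ^ n) x = (T ^ n) (k • u + x) - k • (T ^ n) u := by
      rw [map_add, map_smul]; abel
    rw [norm_smul, Real.norm_of_nonneg (by positivity)] at h4
    rw [h6]
    refine (norm_sub_le _ _).trans ?_
    rw [norm_smul, Real.norm_of_nonneg hk0]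
    calc _ ≤ |C| * (2 * k * s ^ n * ‖u‖) + k * (|C| * (s ^ n * ‖u‖)) := by
          gcongr
          exact h4.trans (by gcongr; exact le_abs_self C)
      _ = 3 * |C| * c * ‖u‖ * s ^ n * ‖x‖ := by rw [hk]; ring
  exact ⟨3 * |C| * c * ‖u‖, fun n ↦
    ContinuousLinearMap.opNorm_le_bound (T ^ n) (by positivity) (hmain n)⟩

open Filter Topology in
/-- An interior supersolution `T u ≤ s • u` excludes spectral values of modulus greater than `s`
that come from a finite-dimensional invariant subspace. -/
theorem norm_le_of_intertwining [OrderClosedTopology X] (hT : IsStronglyPositive T) {u : X}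
    (hu : u ∈ interior {z : X | 0 ≤ z}) {s : ℝ} (hs : 0 ≤ s) (h : T u ≤ s • u) {z : ℂ}
    {g : ℂ →L[ℝ] X} (hg0 : g ≠ 0) (hg : ∀ c, T (g c) = g (z * c)) : ‖z‖ ≤ s := by
  by_contra! hlt
  have hz : 0 < ‖z‖ := hs.trans_lt hlt
  have hz0 : z ≠ 0 := norm_pos_iff.mp hz
  have hpow (n : ℕ) (c : ℂ) : (T ^ n) (g c) = g (z ^ n * c) := by
    induction n generalizing c with
    | zero => simp
    | succ n ih => rw [pow_succ T, mul_apply_eq_comp, hg, ih, pow_succ, mul_assoc]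
  obtain ⟨k, hk, hku⟩ := exists_forall_add_norm_smul_nonneg hu
  -- Write `g c = T ^ n (g (z ^ (-n) c))`: it is at least `-const * (s / ‖z‖) ^ n • u`, which tends
  -- to 0.
  have hnonneg (c : ℂ) : 0 ≤ g c := by
    have hlim : Tendsto (fun n : ℕ ↦ (k * (‖g‖ * ‖c‖) * (s / ‖z‖) ^ n) • u + g c) atTop
        (𝓝 ((k * (‖g‖ * ‖c‖) * 0) • u + g c)) :=
      (((tendsto_pow_atTop_nhds_zero_of_lt_one (by positivity)
        ((div_lt_one hz).mpr hlt)).const_mul _).smul_const u).add_const _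
    rw [mul_zero, zero_smul, zero_add] at hlim
    refine ge_of_tendsto' hlim fun n ↦ ?_
    have h0 : 0 ≤ (k * ‖g ((z ^ n)⁻¹ * c)‖) • u + g ((z ^ n)⁻¹ * c) := hku _
    have h1 := hT.pow_nonneg h0 n
    rw [map_add, map_smul, hpow, mul_inv_cancel_left₀ (pow_ne_zero n hz0)] at h1
    refine h1.trans ?_
    gcongr
    have hu0 : 0 ≤ u := interior_subset hu
    calc (k * ‖g ((z ^ n)⁻¹ * c)‖) • (T ^ n) u ≤ (k * ‖g ((z ^ n)⁻¹ * c)‖) • s ^ n • u :=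
          smul_le_smul_of_nonneg_left (hT.le_smul_pow hs h n) (by positivity)
      _ = (k * ‖g ((z ^ n)⁻¹ * c)‖ * s ^ n) • u := by rw [smul_smul]
      _ ≤ _ := by
          refine smul_le_smul_of_nonneg_right ?_ hu0
          have := g.le_opNorm ((z ^ n)⁻¹ * c)
          rw [norm_mul, norm_inv, norm_pow] at this
          calc k * ‖g ((z ^ n)⁻¹ * c)‖ * s ^ n ≤ k * (‖g‖ * ((‖z‖ ^ n)⁻¹ * ‖c‖)) * s ^ n := by gcongr
            _ = _ := by rw [div_pow]; ring
  refine hg0 (ContinuousLinearMap.ext fun c ↦ (hnonneg c).antisymm' ?_)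
  simpa using hnonneg (-c)

/-- An interior supersolution `T u ≤ s • u` bounds the spectral radius from above if `T` is compact
or the cone is normal. -/
theorem operatorSpectralRadius_le [CompleteSpace X] [OrderClosedTopology X]
    (hT : IsStronglyPositive T) (hK : IsCompactOperator T ∨ HasNormalCone X) {u : X}
    (hu : u ∈ interior {z : X | 0 ≤ z}) {s : NNReal} (hs : 0 < s) (h : T u ≤ (s : ℝ) • u) :
    operatorSpectralRadius T ≤ s := by
  refine iSup₂_le fun z hz ↦ ?_
  suffices ‖z‖ ≤ s by exact_mod_cast this
  rcases hK with hK | hK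
  · rcases eq_or_ne z 0 with rfl | hz0
    · simp
    · obtain ⟨g, hg0, hg⟩ := hK.exists_intertwining_of_mem_spectrum hz0 hz
      exact hT.norm_le_of_intertwining hu s.2 h hg0 hg
  · obtain ⟨C, hC⟩ := hT.exists_norm_pow_le hK hu s.2 h
    exact norm_le_of_mem_spectrum_includeRight_of_pow_le T hs hC hz

end IsStronglyPositive

/-! ### The two comparisons -/

theorem mainTheorem6
    {X Y : Type*} [NormedAddCommGroup X] [NormedSpace ℝ X] [CompleteSpace X]
    [PartialOrder X] [IsOrderedAddMonoid X] [IsOrderedModule ℝ X] [OrderClosedTopology X]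
    [AddCommGroup Y] [Module ℝ Y]
    (L : X →ₗ.[ℝ] Y) (hL : Function.Bijective L.toFun) (M : X →ₗ[ℝ] Y)
    (T : X →L[ℝ] X) (hT : (T : X →ₗ[ℝ] X) = solutionOperator L hL ∘ₗ M)
    (hpos : IsStronglyPositive T)
    (τ : ℝ) (φ : X) (y : Y) (hφ : 0 < φ)
    (heq : τ • φ - solutionOperator L hL (M φ) = solutionOperator L hL y) :
    (solutionOperator L hL y < 0 → (τ : EReal) < (operatorSpectralRadius T : EReal)) ∧
    (IsCompactOperator T ∨ HasNormalCone X →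
      0 < solutionOperator L hL y → (operatorSpectralRadius T : EReal) < (τ : EReal)) := by
  set f := solutionOperator L hL y with hf
  have hM : solutionOperator L hL (M φ) = T φ := (LinearMap.congr_fun hT φ).symm
  rw [hM, sub_eq_iff_eq_add] at heq
  have hu := hpos φ hφ
  have hu0 := hpos.map_pos hφ
  have hTu : T (T φ) = τ • T φ - T f := by
    rw [← map_smul, ← map_sub, heq, add_sub_cancel_left]
  refine ⟨fun hlt ↦ ?_, fun hK hgt ↦ ?_⟩
  · obtain ⟨ε, hε, h1⟩ := exists_pos_smul_le (hpos (-f) (neg_pos.mpr hlt)) (T φ)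
    -- `τ + ε` may be negative; `δ` supplies a nonnegative rate.
    obtain ⟨δ, hδ, h2⟩ := exists_pos_smul_le (hpos _ hu0) (T φ)
    have h3 : (τ + ε) • T φ ≤ T (T φ) := by
      rw [hTu, add_smul, sub_eq_add_neg, ← map_neg]
      gcongr
    have hs : 0 ≤ max (τ + ε) δ := hδ.le.trans (le_max_right _ _)
    have h4 : max (τ + ε) δ • T φ ≤ T (T φ) := by
      rcases max_choice (τ + ε) δ with h | h <;> rw [h] <;> assumption
    have h5 := hpos.le_operatorSpectralRadius (s := ⟨_, hs⟩) hu0 h4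
    calc (τ : EReal) < ((max (τ + ε) δ : ℝ) : EReal) :=
          EReal.coe_lt_coe_iff.mpr ((lt_add_of_pos_right τ hε).trans_le (le_max_left _ _))
      _ ≤ _ := EReal.coe_ennreal_le_coe_ennreal_iff.mpr h5
  · obtain ⟨ε, hε, h1⟩ := exists_pos_smul_le (hpos f hgt) (T φ)
    have h3 : T (T φ) ≤ (τ - ε) • T φ := by
      rw [hTu, sub_smul]
      gcongr
    -- Otherwise `T u ≤ 0`, against `T u > 0`.
    have hs : 0 < τ - ε := by
      by_contra! hs
      exact absurd (hpos.map_pos hu0)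
        (h3.trans (smul_nonpos_of_nonpos_of_nonneg hs hu0.le)).not_gt
    have h5 := hpos.operatorSpectralRadius_le hK hu (s := ⟨_, hs.le⟩) hs h3
    calc (operatorSpectralRadius T : EReal) ≤ ((τ - ε : ℝ) : EReal) :=
          EReal.coe_ennreal_le_coe_ennreal_iff.mpr h5
      _ < τ := EReal.coe_lt_coe_iff.mpr (sub_lt_self τ hε)
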